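/- **Proposition (identifiability of ADMGs under non-linear SCMs).** *Graphs.* An ADMG $G=(G_D,G_B)$ on observed variables $x_1,\dots,x_D$ consists of two binary $D\times D$ adjacency matrices: $[G_D]_{ij}=1$ means $x_i\to x_j$, with no directed cycle, and $[G_B]_{ij}=1$ means $x_i\leftrightarrow x_j$, with $G_B$ symmetric and zero on the diagonal. *Functions.* A function of finitely many real variables is called non-linear if it is measurable, is not Lebesgue-a.e. equal to an affine function (unless it has no variables, when it is a constant), and effectively depends on each of its variables, i.e. is not a.e. equal to a measurable function of the remaining ones. Let $\mathcal F$ be any class of non-linear functions of sub-vectors $(x_m)_{m\in N}$, $N\subseteq\{1,\dots,D\}$, of the observed variables (for instance, all of them). *Model.* We say that a distribution $p$ on $\mathbb R^D$ is of the form $p_\theta(\mathbf x;G)$ if it is the law of $\mathbf x=(x_1,\dots,x_D)$ for random variables $\mathbf x$, latent variables $\mathbf u=(u_1,\dots,u_M)$ (for some $M\ge 0$) and noise variables $\boldsymbol\epsilon=(\epsilon_v)$, one for each variable $v$ of $(\mathbf x,\mathbf u)$, such that: 1. (Additive non-linear magnified SCM.) Almost surely, for every variable $v$ of $(\mathbf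 x,\mathbf u)$, $$v=f_{v,\mathbf x}(\mathbf x_{\mathrm{pa}(v)})+f_{v,\mathbf u}(\mathbf u_{\mathrm{pa}(v)})+\epsilon_v ,$$ where $\mathbf x_{\mathrm{pa}(v)}$ and $\mathbf u_{\mathrm{pa}(v)}$ are the observed and the latent parents of $v$, $f_{v,\mathbf x}\in\mathcal F$, $f_{v,\mathbf u}$ is non-linear, and the noise variables $\epsilon_v$ are mutually independent and have (a.e.) strictly positive Lebesgue densities. Moreover $[G_D]_{ij}=1$ if and only if $x_i$ is a parent of $x_j$, and $[G_B]_{ij}=1$ if and only if $i\ne j$ and $x_i,x_j$ have a common latent parent. 2. (Latent variables confound pairs of non-adjacent observed variables.) Every latent variable has no parents and has exactly two children, which are observed variables not joined by a directed edge; distinct latent variables have distinct pairs of children. 3. (Residual faithfulness.) For all $i\neq j$, all sets $N\not\ni i$, $N'\not\ni j$ of observed variables and all functions $g_i,g_j\in\mathcal F$ of $\mathbf x_N$ and $\mathbf x_{N'}$ respectively: if the residuals $x_i-g_i(\mathbf x_N)$ and $x_j-g_j(\mathbf x_{N'})$ both involve a common noise variable $\epsilon_v$, then they are not independent. Here a random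 variable involves $\epsilon_v$ if it is not a.s. equal to a measurable function of the other noise variables. *Claim.* If $p$ is of the form $p_\theta(\mathbf x;G)$, then $G$ is structurally identifiable from $p$: there is no ADMG $G'$ with $(G'_D,G'_B)\neq(G_D,G_B)$ such that $p$ is also of the form $p_{\theta'}(\mathbf x;G')$. In other words, both $G_D$ and $G_B$ are determined by the observational distribution. -/

import Mathlib

open MeasureTheory ProbabilityTheory

/-- An acyclic directed mixed graph on the observed variables `x_0, …, x_{D-1}`, given by its two
binary adjacency matrices: `GD i j = true` means `x_i → x_j`, `GB i j = true` means `x_i ↔ x_j`. -/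
structure ADMG (D : ℕ) where
  GD : Matrix (Fin D) (Fin D) Bool
  GB : Matrix (Fin D) (Fin D) Bool
  acyclic : ∀ i, ¬ Relation.TransGen (fun a b => GD a b = true) i i
  symm : ∀ i j, GB i j = GB j i
  irrefl : ∀ i, GB i i = false

/-- `g` is (almost everywhere) an affine function of its arguments. -/
def IsAffine {ι : Type} [Fintype ι] (g : (ι → ℝ) → ℝ) : Prop :=
  ∃ (a : ι → ℝ) (b : ℝ), ∀ᵐ z : ι → ℝ, g z = ∑ l, a l * z l + b

/-- `g` effectively depends on its argument number `l`: it is not almost everywhere equal to a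
measurable function of the remaining arguments. -/
def EffectivelyDependsOn {ι : Type} [Fintype ι] (g : (ι → ℝ) → ℝ) (l : ι) : Prop :=
  ¬ ∃ h : ({m : ι // m ≠ l} → ℝ) → ℝ, Measurable h ∧
    ∀ᵐ z : ι → ℝ, g z = h (fun m => z m)

/-- Non-linear functions of finitely many real variables: measurable, effectively depending on
each of the arguments (causal minimality, when `g` is a structural function) and, if there are any
arguments, not affine. A function of no variables is a constant. -/
structure IsNonlinear {ι : Type} [Fintype ι] (g : (ι → ℝ) → ℝ) : Prop where
  measurable : Measurable g
  not_affine : Nonempty ι → ¬ IsAffine g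
  depends : ∀ l, EffectivelyDependsOn g l

/-- A class of functions of (sub-vectors of) the observed variables: for each set `s` of observed
variables, a set of functions of `(x_m)_{m ∈ s}`. -/
abbrev FunctionClass (D : ℕ) : Type := ∀ s : Finset (Fin D), Set ((s → ℝ) → ℝ)

/-- The structural part (graph and functions) of a magnified SCM with `D` observed variables
(`Sum.inl i` is `x_i`) and `M` latent variables (`Sum.inr k` is `u_k`), in which observed and
latent causes enter additively: the equation of the variable `v` has the observed parents `paX v`,
the latent parents `paU v`, and the right-hand side `fX v (x_{paX v}) + fU v (u_{paU v}) + ε_v`. -/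
structure MagnifiedSCM (D M : ℕ) where
  paX : Fin D ⊕ Fin M → Finset (Fin D)
  paU : Fin D ⊕ Fin M → Finset (Fin M)
  fX : ∀ v, (paX v → ℝ) → ℝ
  fU : ∀ v, (paU v → ℝ) → ℝ

namespace MagnifiedSCM

variable {D M : ℕ}

/-- `S` is a magnification of the ADMG `G`: the directed edges of `G` are those between observed
variables of `S`, and its bidirected edges join the distinct observed variables that share a latent
parent. -/
structure IsMagnificationOf (S : MagnifiedSCM D M) (G : ADMG D) : Prop where
  directed : ∀ i j, G.GD i j = true ↔ i ∈ S.paX (Sum.inl j)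
  bidirected : ∀ i j, G.GB i j = true ↔
    i ≠ j ∧ ∃ k, k ∈ S.paU (Sum.inl i) ∧ k ∈ S.paU (Sum.inl j)

/-- The random variables `x`, `u`, `ε` follow the non-linear additive-noise magnified SCM `S`:
`[x, u] = f_X(x) + f_U(u) + ε`, where the functions of the observed variables are from the class
`𝓕`, those of the latent variables are non-linear, and the noise variables are mutually independent
and have strictly positive densities. -/
structure GeneratesData (𝓕 : FunctionClass D) (S : MagnifiedSCM D M)
    {Ω : Type*} [MeasurableSpace Ω] (P : Measure Ω)
    (x : Fin D → Ω → ℝ) (u : Fin M → Ω → ℝ) (ε : Fin D ⊕ Fin M → Ω → ℝ) : Prop where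
  measurable_x : ∀ i, Measurable (x i)
  measurable_u : ∀ k, Measurable (u k)
  measurable_noise : ∀ v, Measurable (ε v)
  structural : ∀ v, ∀ᵐ ω ∂P, Sum.elim x u v ω =
    S.fX v (fun m => x m ω) + S.fU v (fun k => u k ω) + ε v ω
  fX_mem : ∀ v, S.fX v ∈ 𝓕 (S.paX v)
  fU_nonlinear : ∀ v, IsNonlinear (S.fU v)
  indep : iIndepFun ε P
  noise_density : ∀ v, P.map (ε v) ≪ volume
  noise_positive : ∀ v, volume ≪ P.map (ε v)

/-- Every latent variable is a parentless confounder of a pair of non-adjacent observed variables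
(these two are its only children), and no two latent variables confound the same pair. -/
structure LatentsConfoundUniquePairs (S : MagnifiedSCM D M) : Prop where
  parentless : ∀ k, S.paX (Sum.inr k) = ∅ ∧ S.paU (Sum.inr k) = ∅
  pair : ∀ k, ∃ i j, i ≠ j ∧ i ∉ S.paX (Sum.inl j) ∧ j ∉ S.paX (Sum.inl i) ∧
    ∀ l, k ∈ S.paU (Sum.inl l) ↔ l = i ∨ l = j
  unique : ∀ k k', (∀ l, k ∈ S.paU (Sum.inl l) ↔ k' ∈ S.paU (Sum.inl l)) → k = k'

end MagnifiedSCM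

/-- The random variable `R` has terms involving the noise `ε_l`: it is not almost surely equal to a
measurable function of the other noise variables. -/
def Involves {Ω ι : Type*} [MeasurableSpace Ω] (P : Measure Ω) (ε : ι → Ω → ℝ) (R : Ω → ℝ)
    (l : ι) : Prop :=
  ¬ ∃ h : ({m : ι // m ≠ l} → ℝ) → ℝ, Measurable h ∧ R =ᵐ[P] fun ω => h (fun m => ε m ω)

/-- The residual `x_i - g((x_m)_{m ∈ s})`. -/
def regResidual {Ω : Type*} {D : ℕ} (x : Fin D → Ω → ℝ) (i : Fin D) (s : Finset (Fin D))
    (g : (s → ℝ) → ℝ) : Ω → ℝ :=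
  fun ω => x i ω - g (fun m => x m ω)

/-- Residual faithfulness of the functions of the class `𝓕`: if the residuals of two distinct
observed variables, each after subtracting a function of some of the other observed variables, both
have terms involving the same noise variable, then they are dependent. -/
def ResidualFaithful {D : ℕ} {Ω ι : Type*} [MeasurableSpace Ω] (𝓕 : FunctionClass D)
    (P : Measure Ω) (x : Fin D → Ω → ℝ) (ε : ι → Ω → ℝ) : Prop :=
  ∀ i j, i ≠ j → ∀ s t : Finset (Fin D), i ∉ s → j ∉ t → ∀ g ∈ 𝓕 s, ∀ h ∈ 𝓕 t,
    (∃ l, Involves P ε (regResidual x i s g) l ∧ Involves P ε (regResidual x j t h) l) →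
      ¬ IndepFun (regResidual x i s g) (regResidual x j t h) P

/-- `p` is one of the distributions `p_θ(x; G)`: the law of the observed variables of some data
generating process satisfying the assumptions, with ADMG `G`. (Only the joint law of the finitely
many real variables matters, so probability spaces in `Type` suffice.) -/
def IsObservationalDistribution {D : ℕ} (𝓕 : FunctionClass D) (G : ADMG D)
    (p : Measure (Fin D → ℝ)) : Prop :=
  ∃ (M : ℕ) (S : MagnifiedSCM D M) (Ω : Type) (_ : MeasurableSpace Ω) (P : Measure Ω)
    (x : Fin D → Ω → ℝ) (u : Fin M → Ω → ℝ) (ε : Fin D ⊕ Fin M → Ω → ℝ),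
    IsProbabilityMeasure P ∧ S.IsMagnificationOf G ∧ S.GeneratesData 𝓕 P x u ε ∧
    S.LatentsConfoundUniquePairs ∧ ResidualFaithful 𝓕 P x ε ∧
    P.map (fun ω i => x i ω) = p

/-- The ADMG `G` is structurally identifiable from `p`: no other ADMG generates `p`. -/
def StructurallyIdentifiable {D : ℕ} (𝓕 : FunctionClass D) (G : ADMG D)
    (p : Measure (Fin D → ℝ)) : Prop :=
  ¬ ∃ G' : ADMG D, (G'.GD, G'.GB) ≠ (G.GD, G.GB) ∧ IsObservationalDistribution 𝓕 G' p

/-! Let `R_v` be `x_v` minus the observed part of its equation in model `S`, and `R'_v` the same for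
`S'`. In its own model a residual is a.s. a function of the noise of `x_v` and of its latent
parents. So residuals of variables joined by a directed edge, which share no latent parent, are
independent. This is a property of the law of `x`, hence also holds in the other model, where
residual faithfulness says that the two residuals share no noise.

Order (`rank_lt_of_indepFun`): if some `S'`-parent of `v` had `S`-rank at least that of `v`, take
the parent `w` of largest rank. Inductively the `S'`-parents of `w` have smaller rank, so `R'_v` and
`R'_w` both involve the noise of `x_w`, a contradiction. Thus one rank serves both models.

Functions (`isAEConstantIn_residual_sub`): let `w` have the largest rank among the coordinates in
which `R'_v - R_v` is not a.e. constant. It is a parent of `v` in one model. If in `S'`, then `R'_w`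
involves the noise of `x_w`, so `R'_v` does not; neither does `R_v`, and maximality makes the
difference constant in `x_w`. The case of `S` is symmetric. Hence the residuals differ by constants:
effective dependence recovers the directed edges, and dependence of residuals, unaffected by shifts,
recovers the bidirected ones.

Involvement of noise becomes dependence on coordinates because the noise law is equivalent to
Lebesgue measure, solving the equations preserves volume, and the noise of `x_w` moves no other
variable of rank at most that of `x_w`. -/

theorem measurable_update_prod {ι : Type*} [DecidableEq ι] (w : ι) :
    Measurable fun q : (ι → ℝ) × ℝ => Function.update q.1 w q.2 :=
  measurable_pi_lambda _ fun i => by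
    by_cases h : i = w
    · subst h; simpa using measurable_snd
    · simpa only [Function.update_of_ne h] using measurable_fst.eval

/-! ### Null sets under projections and coordinate changes -/

section ProductMeasures

variable {ι κ : Type*} [Fintype ι] [Fintype κ]

theorem absolutelyContinuous_pi_fin : ∀ (n : ℕ) (μ ν : Fin n → Measure ℝ)
    [∀ i, SigmaFinite (μ i)] [∀ i, SigmaFinite (ν i)], (∀ i, μ i ≪ ν i) →
    Measure.pi μ ≪ Measure.pi ν
  | 0, μ, ν, _, _, _ => by
    rw [Measure.pi_of_empty, Measure.pi_of_empty]
  | n + 1, μ, ν, _, _, h => by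
    have h1 := (measurePreserving_piFinSuccAbove μ 0).symm
    have h2 := (measurePreserving_piFinSuccAbove ν 0).symm
    rw [← h1.map_eq, ← h2.map_eq]
    exact ((h 0).prod (absolutelyContinuous_pi_fin n _ _ fun j => h _)).map h1.measurable

theorem absolutelyContinuous_pi {μ ν : ι → Measure ℝ}
    [∀ i, SigmaFinite (μ i)] [∀ i, SigmaFinite (ν i)] (h : ∀ i, μ i ≪ ν i) :
    Measure.pi μ ≪ Measure.pi ν := by
  let e := (Fintype.equivFin ι).symm
  have h1 := measurePreserving_piCongrLeft μ e
  have h2 := measurePreserving_piCongrLeft ν e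
  rw [← h1.map_eq, ← h2.map_eq]
  exact (absolutelyContinuous_pi_fin _ _ _ fun j => h _).map h1.measurable

theorem pi_map_comp_injective (μ : Measure ℝ) [IsProbabilityMeasure μ] {j : κ → ι}
    (hj : Function.Injective j) :
    (Measure.pi fun _ : ι => μ).map (fun z k => z (j k)) = Measure.pi fun _ : κ => μ := by
  refine (Measure.pi_eq fun s hs => ?_).symm
  rw [Measure.map_apply (by fun_prop) (MeasurableSet.univ_pi hs)]
  have : (fun (z : ι → ℝ) k => z (j k)) ⁻¹' Set.univ.pi s
      = Set.univ.pi (Function.extend j s fun _ => Set.univ) := by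
    ext z
    simp only [Set.mem_preimage, Set.mem_univ_pi]
    refine ⟨fun h i => ?_, fun h k => ?_⟩
    · by_cases hi : ∃ k, j k = i
      · obtain ⟨k, rfl⟩ := hi
        rw [hj.extend_apply]
        exact h k
      · rw [Function.extend_apply' _ _ _ hi]
        trivial
    · simpa only [hj.extend_apply] using h (j k)
  rw [this, Measure.pi_pi]
  refine (Fintype.prod_of_injective j hj _ _ (fun i hi => ?_) fun k => ?_).symm
  · rw [Function.extend_apply' _ _ _ hi, measure_univ]
  · rw [hj.extend_apply]

/-- Resampling one coordinate independently leaves a product probability measure unchanged. -/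
theorem pi_prod_map_update [DecidableEq ι] (μ : Measure ℝ) [IsProbabilityMeasure μ] (w : ι) :
    ((Measure.pi fun _ : ι => μ).prod μ).map (fun q => Function.update q.1 w q.2)
      = Measure.pi fun _ : ι => μ := by
  have hm := measurable_update_prod (ι := ι) w
  refine (Measure.pi_eq fun s hs => ?_).symm
  rw [Measure.map_apply hm (MeasurableSet.univ_pi hs)]
  have : (fun q : (ι → ℝ) × ℝ => Function.update q.1 w q.2) ⁻¹' Set.univ.pi s
      = (Set.univ.pi (Function.update s w Set.univ)) ×ˢ s w := by
    ext ⟨z, t⟩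
    simp only [Set.mem_preimage, Set.mem_univ_pi, Set.mem_prod]
    refine ⟨fun h => ⟨fun i => ?_, by simpa using h w⟩, fun h i => ?_⟩
    · by_cases hi : i = w
      · subst hi; simp
      · simpa [Function.update_of_ne hi] using h i
    · by_cases hi : i = w
      · subst hi; simpa using h.2
      · simpa [Function.update_of_ne hi] using h.1 i
  rw [this, Measure.prod_prod, Measure.pi_pi, ← Finset.prod_erase_mul _ _ (Finset.mem_univ w),
    ← Finset.prod_erase_mul (a := w) Finset.univ (fun i => μ (s i)) (Finset.mem_univ w)]
  simp only [Function.update_self, measure_univ, mul_one]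
  congr 1
  exact Finset.prod_congr rfl fun i hi => by rw [Function.update_of_ne (Finset.ne_of_mem_erase hi)]

/-- Projections do not push Lebesgue measure to Lebesgue measure, as the fibres have infinite mass.
An equivalent product of probability measures projects correctly and has the same null sets. -/
theorem volume_ac_pi_gaussian :
    (volume : Measure (ι → ℝ)) ≪ Measure.pi fun _ : ι => gaussianReal 0 1 :=
  absolutelyContinuous_pi fun _ => gaussianReal_absolutelyContinuous' 0 one_ne_zero

theorem pi_gaussian_ac_volume :
    (Measure.pi fun _ : ι => gaussianReal 0 1) ≪ (volume : Measure (ι → ℝ)) :=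
  absolutelyContinuous_pi fun _ => gaussianReal_absolutelyContinuous 0 one_ne_zero

/-- Dropping coordinates sends non-null sets to non-null sets. -/
theorem volume_ac_map_comp_injective {j : κ → ι} (hj : Function.Injective j) :
    (volume : Measure (κ → ℝ)) ≪ (volume : Measure (ι → ℝ)).map fun z k => z (j k) := by
  refine volume_ac_pi_gaussian.trans ?_
  rw [← pi_map_comp_injective (gaussianReal 0 1) hj]
  exact pi_gaussian_ac_volume.map (by fun_prop)

theorem quasiMeasurePreserving_comp_injective {j : κ → ι} (hj : Function.Injective j) :
    Measure.QuasiMeasurePreserving (fun (z : ι → ℝ) k => z (j k)) volume volume := by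
  refine ⟨by fun_prop, ?_⟩
  refine Measure.AbsolutelyContinuous.trans ?_ pi_gaussian_ac_volume
  rw [← pi_map_comp_injective (gaussianReal 0 1) hj]
  exact volume_ac_pi_gaussian.map (by fun_prop)

theorem ae_of_ae_comp_injective {j : κ → ι} (hj : Function.Injective j) {q : (κ → ℝ) → Prop}
    (h : ∀ᵐ z : ι → ℝ, q fun k => z (j k)) (hq : MeasurableSet {y | q y}) : ∀ᵐ y : κ → ℝ, q y :=
  (volume_ac_map_comp_injective hj).ae_le ((ae_map_iff (f := fun (z : ι → ℝ) k => z (j k))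
    (Measurable.aemeasurable (by fun_prop)) hq).2 h)

/-- A property of almost every point holds after almost every change of one coordinate. -/
theorem ae_ae_update [DecidableEq ι] (w : ι) {q : (ι → ℝ) → Prop} (h : ∀ᵐ z, q z) :
    ∀ᵐ z, ∀ᵐ t : ℝ, q (Function.update z w t) := by
  have h1 : Measure.QuasiMeasurePreserving (fun q : (ι → ℝ) × ℝ => Function.update q.1 w q.2)
      (volume.prod volume) volume := by
    refine ⟨measurable_update_prod w, ?_⟩
    refine Measure.AbsolutelyContinuous.trans ?_ pi_gaussian_ac_volume
    rw [← pi_prod_map_update (gaussianReal 0 1) w]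
    exact (volume_ac_pi_gaussian.prod
      (gaussianReal_absolutelyContinuous' 0 one_ne_zero)).map (measurable_update_prod w)
  exact Measure.ae_ae_of_ae_prod (h1.ae h)

end ProductMeasures

/-! ### Solving triangular structural equations -/

section Shear

variable {ι : Type*} (r : ι → ℕ) (φ : ι → (ι → ℝ) → ℝ)

/-- The structural equations `z = φ(z) + e` solved for the noise. -/
def shear (z : ι → ℝ) : ι → ℝ := fun v => z v - φ v z

/-- The structural equations `z = φ(z) + e`, iterated `n` times. -/
def solveIter : ℕ → (ι → ℝ) → ι → ℝ
  | 0, e => e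
  | n + 1, e => fun v => e v + φ v (solveIter n e)

variable {r φ}

theorem measurable_shear (hφ : ∀ v, Measurable (φ v)) : Measurable (shear φ) :=
  measurable_pi_lambda _ fun v => (measurable_pi_apply v).sub (hφ v)

theorem measurable_solveIter (hφ : ∀ v, Measurable (φ v)) : ∀ n, Measurable (solveIter φ n)
  | 0 => measurable_id
  | n + 1 => measurable_pi_lambda _ fun v =>
      (measurable_pi_apply v).add ((hφ v).comp (measurable_solveIter hφ n))

/-- Each equation reads only smaller ranks, so every iteration makes one more rank correct. -/
theorem solveIter_shear (hd : ∀ v, DependsOn (φ v) {m | r m < r v}) (z : ι → ℝ) :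
    ∀ n v, r v < n → solveIter φ n (shear φ z) v = z v := by
  intro n
  induction n with
  | zero => intro v hv; omega
  | succ n ih =>
    intro v hv
    have : φ v (solveIter φ n (shear φ z)) = φ v z :=
      hd v fun m (hm : r m < r v) => ih m (by omega)
    simp [solveIter, shear, this]

theorem solveIter_stable (hd : ∀ v, DependsOn (φ v) {m | r m < r v}) (e : ι → ℝ) :
    ∀ n v, r v < n → solveIter φ (n + 1) e v = solveIter φ n e v := by
  intro n
  induction n with
  | zero => intro v hv; omega
  | succ n ih =>
    intro v hv
    have : φ v (solveIter φ (n + 1) e) = φ v (solveIter φ n e) :=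
      hd v fun m (hm : r m < r v) => ih m (by omega)
    change e v + _ = e v + _
    rw [this]

variable [Fintype ι]

variable (r φ) in
/-- The solution of the structural equations `z = φ(z) + e`. -/
def solve (e : ι → ℝ) : ι → ℝ := solveIter φ (Finset.univ.sup r + 1) e

theorem measurable_solve (hφ : ∀ v, Measurable (φ v)) : Measurable (solve r φ) :=
  measurable_solveIter hφ _

theorem solve_shear (hd : ∀ v, DependsOn (φ v) {m | r m < r v}) (z : ι → ℝ) :
    solve r φ (shear φ z) = z :=
  funext fun v => solveIter_shear hd z _ v
    (Nat.lt_succ_of_le (Finset.le_sup (f := r) (Finset.mem_univ v)))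

theorem solve_eq (hd : ∀ v, DependsOn (φ v) {m | r m < r v}) (e : ι → ℝ) (v : ι) :
    solve r φ e v = e v + φ v (solve r φ e) :=
  (solveIter_stable hd e _ v
    (Nat.lt_succ_of_le (Finset.le_sup (f := r) (Finset.mem_univ v)))).symm

/-- Noise of a variable does not enter the other variables up to its rank. -/
theorem solve_update_of_le [DecidableEq ι] (hd : ∀ v, DependsOn (φ v) {m | r m < r v})
    (e : ι → ℝ) (w : ι) (t : ℝ) : ∀ n v, r v = n → n ≤ r w → v ≠ w →
    solve r φ (Function.update e w t) v = solve r φ e v := by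
  intro n
  induction n using Nat.strong_induction_on with
  | _ n ih =>
    intro v hv hn hne
    rw [solve_eq hd, solve_eq hd e, Function.update_of_ne hne]
    congr 1
    refine hd v fun m (hm : r m < r v) => ih (r m) (by omega) m rfl (by omega) ?_
    rintro rfl
    omega

/-- The mechanism of `w` reads only smaller ranks, which the noise of `w` does not reach; that noise
therefore acts on `w` as a translation. -/
theorem solve_update_self [DecidableEq ι] (hd : ∀ v, DependsOn (φ v) {m | r m < r v})
    (e : ι → ℝ) (w : ι) (t : ℝ) :
    solve r φ (Function.update e w t) w = t + φ w (solve r φ e) := by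
  rw [solve_eq hd, Function.update_self]
  congr 1
  refine hd w fun m (hm : r m < r w) => solve_update_of_le hd e w t _ m rfl hm.le ?_
  rintro rfl
  omega

/-- The shear of the coordinates of rank `n` alone preserves volume. -/
theorem measurePreserving_shear_rank (hφ : ∀ v, Measurable (φ v))
    (hd : ∀ v, DependsOn (φ v) {m | r m < r v}) (n : ℕ) :
    MeasurePreserving (shear fun v z => if r v = n then φ v z else 0)
      (volume : Measure (ι → ℝ)) volume := by
  classical
  let e := MeasurableEquiv.piEquivPiSubtypeProd (fun _ : ι => ℝ) fun i => r i ≠ n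
  have he : MeasurePreserving e volume volume :=
    volume_preserving_piEquivPiSubtypeProd (fun _ : ι => ℝ) fun i => r i ≠ n
  -- The mechanisms at rank `n` ignore the coordinates of rank `n`, so these are filled with the
  -- dummy value 0.
  let ψ : ({i // r i ≠ n} → ℝ) → {i // ¬ r i ≠ n} → ℝ := fun a i => φ i (e.symm (a, 0))
  have hψ : Measurable ψ := measurable_pi_lambda _ fun i =>
    (hφ i).comp (e.symm.measurable.comp (measurable_id.prodMk measurable_const))
  have hs : MeasurePreserving (fun q : ({i // r i ≠ n} → ℝ) × ({i // ¬ r i ≠ n} → ℝ) =>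
      (q.1, q.2 - ψ q.1)) (volume.prod volume) (volume.prod volume) :=
    (MeasurePreserving.id volume).skew_product (g := fun a b => b - ψ a)
      (measurable_snd.sub (hψ.comp measurable_fst))
      (ae_of_all _ fun a => (measurePreserving_sub_right volume (ψ a)).map_eq)
  have key : (shear fun v z => if r v = n then φ v z else 0) = e.symm ∘
      (fun q : ({i // r i ≠ n} → ℝ) × ({i // ¬ r i ≠ n} → ℝ) => (q.1, q.2 - ψ q.1)) ∘ e := by
    funext z v
    by_cases hv : r v = n
    · have h1 : φ v (e.symm ((e z).1, 0)) = φ v z := hd v fun m (hm : r m < r v) => by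
        have : r m ≠ n := by omega
        simp [e, MeasurableEquiv.piEquivPiSubtypeProd, Equiv.piEquivPiSubtypeProd, this]
      have h2 : ψ (e z).1 ⟨v, not_not.2 hv⟩ = φ v z := h1
      simp only [shear, hv, if_true, Function.comp_apply]
      change _ = (if h : r v ≠ n then _ else _)
      rw [dif_neg (not_not.2 hv)]
      change _ = z v - ψ (e z).1 ⟨v, not_not.2 hv⟩
      rw [h2]
    · simp only [shear, hv, if_false, Function.comp_apply]
      change _ = (if h : r v ≠ n then _ else _)
      rw [dif_pos hv]
      simp [e, MeasurableEquiv.piEquivPiSubtypeProd]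
  rw [key]
  exact he.symm.comp (hs.comp he)

theorem measurePreserving_shear_of_le (hφ : ∀ v, Measurable (φ v))
    (hd : ∀ v, DependsOn (φ v) {m | r m < r v}) (n : ℕ) :
    MeasurePreserving (shear fun v z => if r v < n then φ v z else 0)
      (volume : Measure (ι → ℝ)) volume := by
  induction n with
  | zero =>
    have : (shear fun (v : ι) z => if r v < 0 then φ v z else 0) = id := by
      funext z v; simp [shear]
    rw [this]
    exact MeasurePreserving.id _
  | succ n ih =>
    have : (shear fun (v : ι) z => if r v < n + 1 then φ v z else 0) =
        (shear fun v z => if r v < n then φ v z else 0) ∘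
          shear fun v z => if r v = n then φ v z else 0 := by
      funext z v
      rcases lt_trichotomy (r v) n with h | h | h
      · have : φ v (shear (fun v z => if r v = n then φ v z else 0) z) = φ v z :=
          hd v fun m (hm : r m < r v) => by
            have : r m ≠ n := by omega
            simp [shear, this]
        simp only [Function.comp_apply, shear] at this ⊢
        simp [h, h.ne, h.trans (Nat.lt_succ_self n), this]
      · simp [shear, h]
      · have h1 : ¬ r v < n + 1 := by omega
        have h2 : ¬ r v < n := by omega
        simp [shear, h1, h2, h.ne']
    rw [this]
    exact ih.comp (measurePreserving_shear_rank hφ hd n)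

theorem measurePreserving_shear (hφ : ∀ v, Measurable (φ v))
    (hd : ∀ v, DependsOn (φ v) {m | r m < r v}) :
    MeasurePreserving (shear φ) (volume : Measure (ι → ℝ)) volume := by
  have h := measurePreserving_shear_of_le hφ hd (Finset.univ.sup r + 1)
  have h1 : ∀ v, r v < Finset.univ.sup r + 1 := fun v =>
    Nat.lt_succ_of_le (Finset.le_sup (f := r) (Finset.mem_univ v))
  simpa only [h1, if_true] using h

/-- `solve` is a left inverse of the volume-preserving shear. -/
theorem measurePreserving_solve (hφ : ∀ v, Measurable (φ v))
    (hd : ∀ v, DependsOn (φ v) {m | r m < r v}) :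
    MeasurePreserving (solve r φ) (volume : Measure (ι → ℝ)) volume := by
  refine ⟨measurable_solve hφ, ?_⟩
  conv_lhs => rw [← (measurePreserving_shear hφ hd).map_eq]
  rw [Measure.map_map (measurable_solve hφ) (measurable_shear hφ),
    show solve r φ ∘ shear φ = id from funext (solve_shear hd), Measure.map_id]

end Shear

theorem measurableSet_ae_update_eq {ι : Type*} [DecidableEq ι] {F : (ι → ℝ) → ℝ}
    (hF : Measurable F) (w : ι) :
    MeasurableSet {z | ∀ᵐ t : ℝ, F (Function.update z w t) = F z} := by
  have hB : MeasurableSet {q : (ι → ℝ) × ℝ | ¬ F (Function.update q.1 w q.2) = F q.1} :=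
    (measurableSet_eq_fun (hF.comp (measurable_update_prod w)) (hF.comp measurable_fst)).compl
  exact (measurable_measure_prodMk_left (ν := volume) hB) (measurableSet_singleton 0)

/-! ### Almost everywhere constancy in a coordinate -/

section AEConstant

variable {ι κ : Type*} [Fintype ι] [Fintype κ]

/-- `F` is almost everywhere unchanged by almost every change of the coordinate `w`. -/
def IsAEConstantIn [DecidableEq ι] (F : (ι → ℝ) → ℝ) (w : ι) : Prop :=
  ∀ᵐ z, ∀ᵐ t : ℝ, F (Function.update z w t) = F z

variable [DecidableEq ι] {F F' : (ι → ℝ) → ℝ} {w : ι}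

theorem IsAEConstantIn.congr (h : IsAEConstantIn F w) (hFF' : F =ᵐ[volume] F') :
    IsAEConstantIn F' w := by
  filter_upwards [h, hFF', ae_ae_update w hFF'] with z h1 h2 h3
  filter_upwards [h1, h3] with t h4 h5
  rw [← h5, h4, h2]

/-- By Fubini almost every value `t` works for almost all `z`, so a single `t` can be fixed. -/
theorem IsAEConstantIn.exists_update (hF : Measurable F) (h : IsAEConstantIn F w) :
    ∃ t : ℝ, ∀ᵐ z, F (Function.update z w t) = F z := by
  have hB : MeasurableSet {q : (ι → ℝ) × ℝ | F (Function.update q.1 w q.2) = F q.1} :=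
    measurableSet_eq_fun (hF.comp (measurable_update_prod w)) (hF.comp measurable_fst)
  have h1 : ∀ᵐ t : ℝ, ∀ᵐ z, F (Function.update z w t) = F z :=
    (Measure.ae_ae_comm (μ := volume) (ν := volume) hB).1 h
  exact h1.exists

/-- A function that is almost everywhere constant in some coordinates has a version that does not
depend on them. -/
theorem exists_dependsOn_of_isAEConstantIn (hF : Measurable F) (A : Finset ι)
    (h : ∀ w ∈ A, IsAEConstantIn F w) :
    ∃ F' : (ι → ℝ) → ℝ, Measurable F' ∧ F =ᵐ[volume] F' ∧ DependsOn F' (A : Set ι)ᶜ := by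
  induction A using Finset.induction_on with
  | empty => exact ⟨F, hF, ae_eq_refl _, fun a b hab => congrArg F (funext fun i => hab i (by simp))⟩
  | insert w A _ ih =>
    obtain ⟨F', hm, he, hd⟩ := ih fun v hv => h v (Finset.mem_insert_of_mem hv)
    obtain ⟨t, ht⟩ := ((h w (Finset.mem_insert_self _ _)).congr he).exists_update hm
    refine ⟨fun z => F' (Function.update z w t), hm.comp (by fun_prop), ?_, fun a b hab => ?_⟩
    · filter_upwards [he, ht] with z h1 h2
      rw [h1, h2]
    · refine hd fun i hi => ?_
      by_cases hiw : i = w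
      · subst hiw; simp
      · simp only [Function.update_of_ne hiw]
        exact hab i (by simpa [hiw] using hi)

theorem IsAEConstantIn.of_comp_injective [DecidableEq κ] {j : κ → ι} (hj : Function.Injective j)
    {g : (κ → ℝ) → ℝ} (hg : Measurable g) {l : κ}
    (h : IsAEConstantIn (fun z => g fun k => z (j k)) (j l)) : IsAEConstantIn g l := by
  refine ae_of_ae_comp_injective hj ?_ (measurableSet_ae_update_eq hg l)
  filter_upwards [h] with z hz
  filter_upwards [hz] with t ht
  rw [← ht]
  exact congrArg g (Function.update_comp_eq_of_injective z hj l t).symm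

/-- Freezing the coordinate `l` at a good value gives a measurable version in the remaining
variables. -/
theorem IsAEConstantIn.not_effectivelyDependsOn {ι : Type} [Fintype ι] [DecidableEq ι]
    {g : (ι → ℝ) → ℝ} (hg : Measurable g) {l : ι} (h : IsAEConstantIn g l) :
    ¬ EffectivelyDependsOn g l := by
  obtain ⟨t, ht⟩ := h.exists_update hg
  refine not_not.2 ⟨fun y => g fun i => if hi : i = l then t else y ⟨i, hi⟩, hg.comp ?_, ?_⟩
  · refine measurable_pi_lambda _ fun i => ?_
    by_cases hi : i = l
    · simp [hi]
    · simpa [hi] using measurable_pi_apply _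
  · filter_upwards [ht] with z hz
    rw [← hz]
    congr 1
    funext i
    by_cases hi : i = l
    · subst hi; simp
    · simp [hi]

/-- The noise `ε_l` is involved in `F(ε)` as soon as `F` is not constant in its coordinate `l`. -/
theorem isAEConstantIn_of_not_involves {Ω : Type*} [MeasurableSpace Ω] {P : Measure Ω}
    {ε : ι → Ω → ℝ} (hε : ∀ v, Measurable (ε v))
    (hac : volume ≪ P.map fun ω v => ε v ω) (hF : Measurable F) {R : Ω → ℝ}
    (hR : R =ᵐ[P] fun ω => F fun v => ε v ω) {l : ι} (hl : ¬ Involves P ε R l) :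
    IsAEConstantIn F l := by
  obtain ⟨h, hh, hRh⟩ := not_not.1 hl
  have h1 : ∀ᵐ e : ι → ℝ, F e = h fun m : {m : ι // m ≠ l} => e m := by
    refine hac.ae_le ((ae_map_iff (measurable_pi_lambda _ hε).aemeasurable
      (measurableSet_eq_fun hF (hh.comp (by fun_prop)))).2 ?_)
    filter_upwards [hR, hRh] with ω h2 h3
    exact h2.symm.trans h3
  filter_upwards [h1, ae_ae_update l h1] with e h2 h3
  filter_upwards [h3] with t h4
  rw [h4, h2]
  congr 1
  funext m
  exact Function.update_of_ne m.2 _ _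

end AEConstant

theorem ae_of_ae_add_right {q : ℝ → Prop} (c : ℝ) (h : ∀ᵐ t : ℝ, q (t + c)) : ∀ᵐ t : ℝ, q t := by
  have := (measurePreserving_sub_right (volume : Measure ℝ) c).quasiMeasurePreserving.ae h
  simpa using this

/-! ### From noise to observed variables -/

namespace MagnifiedSCM

variable {D M : ℕ}

/-- The equations of `S` are measurable and can be solved successively: the latent variables have
no parents, and the observed parents of an observed variable have smaller rank. -/
structure Recursive (S : MagnifiedSCM D M) (r : Fin D → ℕ) : Prop where
  paX_latent : ∀ k, S.paX (Sum.inr k) = ∅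
  paU_latent : ∀ k, S.paU (Sum.inr k) = ∅
  rank_lt : ∀ i, ∀ m ∈ S.paX (Sum.inl i), r m < r i
  measurable_fX : ∀ v, Measurable (S.fX v)
  measurable_fU : ∀ v, Measurable (S.fU v)

/-- The rank of all the variables, given that of the observed ones. -/
def fullRank (M : ℕ) (r : Fin D → ℕ) : Fin D ⊕ Fin M → ℕ :=
  Sum.elim (fun i => r i + 1) fun _ => 0

/-- The part of the structural equation of `v` that is not noise. -/
def mechanism (S : MagnifiedSCM D M) (v : Fin D ⊕ Fin M) (z : Fin D ⊕ Fin M → ℝ) : ℝ :=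
  S.fX v (fun m => z (Sum.inl m)) + S.fU v (fun k => z (Sum.inr k))

/-- The residual of `x_i` after subtracting the observed part of its structural equation. -/
def residual (S : MagnifiedSCM D M) (i : Fin D) (z : Fin D → ℝ) : ℝ :=
  z i - S.fX (Sum.inl i) fun m => z m

variable {S : MagnifiedSCM D M} {r : Fin D → ℕ}

theorem Recursive.measurable_mechanism (h : S.Recursive r) (v) : Measurable (S.mechanism v) :=
  ((h.measurable_fX v).comp (by fun_prop)).add ((h.measurable_fU v).comp (by fun_prop))

theorem Recursive.measurable_residual (h : S.Recursive r) (i) : Measurable (S.residual i) :=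
  (measurable_pi_apply i).sub ((h.measurable_fX _).comp (by fun_prop))

/-- Latent variables have rank 0 and observed ranks are shifted by one, so latent parents always
come strictly first. -/
theorem Recursive.dependsOn_mechanism (h : S.Recursive r) :
    ∀ v, DependsOn (S.mechanism v) {m | fullRank M r m < fullRank M r v}
  | Sum.inl i => fun a b hab => by
    refine congrArg₂ (· + ·) (congrArg _ (funext fun m => ?_)) (congrArg _ (funext fun k => ?_))
    · exact hab _ (by simpa [fullRank] using h.rank_lt i m m.2)
    · exact hab _ (by simp [fullRank])
  | Sum.inr k => fun a b _ => by
    refine congrArg₂ (· + ·) (congrArg _ (funext fun m => ?_)) (congrArg _ (funext fun l => ?_))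
    · exact absurd m.2 (by simp [h.paX_latent k])
    · exact absurd l.2 (by simp [h.paU_latent k])

variable {𝓕 : FunctionClass D} {Ω : Type*} [MeasurableSpace Ω] {P : Measure Ω}
  {x : Fin D → Ω → ℝ} {u : Fin M → Ω → ℝ} {ε : Fin D ⊕ Fin M → Ω → ℝ}

namespace GeneratesData

theorem measurable_noise_vector (hS : S.GeneratesData 𝓕 P x u ε) :
    Measurable fun ω v => ε v ω :=
  measurable_pi_lambda _ hS.measurable_noise

theorem measurable_observed (hS : S.GeneratesData 𝓕 P x u ε) : Measurable fun ω i => x i ω :=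
  measurable_pi_lambda _ hS.measurable_x

theorem ae_eq_solve (hS : S.GeneratesData 𝓕 P x u ε) (h : S.Recursive r) :
    ∀ᵐ ω ∂P, (fun v => Sum.elim x u v ω) =
      solve (fullRank M r) S.mechanism fun v => ε v ω := by
  filter_upwards [ae_all_iff.2 hS.structural] with ω hω
  rw [← solve_shear h.dependsOn_mechanism fun v => Sum.elim x u v ω]
  congr 1
  funext v
  have := hω v
  simp only [shear, mechanism, Sum.elim_inl, Sum.elim_inr]
  linarith

theorem ae_observed_eq_solve (hS : S.GeneratesData 𝓕 P x u ε) (h : S.Recursive r) :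
    (fun ω i => x i ω) =ᵐ[P] fun ω i =>
      solve (fullRank M r) S.mechanism (fun v => ε v ω) (Sum.inl i) := by
  filter_upwards [hS.ae_eq_solve h] with ω hω
  funext i
  exact congrFun hω (Sum.inl i)

/-- What remains is the latent part plus the own noise. A latent variable has no parents, so it is
its noise plus a constant, namely its mechanism evaluated at 0. -/
theorem residual_ae_eq (hS : S.GeneratesData 𝓕 P x u ε) (h : S.Recursive r) (i : Fin D) :
    (fun ω => S.residual i fun l => x l ω) =ᵐ[P] fun ω =>
      S.fU (Sum.inl i) (fun k => ε (Sum.inr k) ω + S.mechanism (Sum.inr k) 0) +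
        ε (Sum.inl i) ω := by
  filter_upwards [ae_all_iff.2 hS.structural] with ω hω
  have h1 : (fun k : S.paU (Sum.inl i) => u k ω) =
      fun k : S.paU (Sum.inl i) => ε (Sum.inr k) ω + S.mechanism (Sum.inr k) 0 := by
    funext k
    have h2 := hω (Sum.inr k)
    have h3 : S.mechanism (Sum.inr k) (fun v => Sum.elim x u v ω) = S.mechanism (Sum.inr k) 0 :=
      h.dependsOn_mechanism _ fun m hm => by simp [fullRank] at hm
    rw [← h3]
    simp only [Sum.elim_inr, mechanism, Sum.elim_inl] at h2 ⊢
    linarith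
  have h4 := hω (Sum.inl i)
  rw [← h1]
  simp only [residual, Sum.elim_inl] at h4 ⊢
  linarith

theorem observed_law (hS : S.GeneratesData 𝓕 P x u ε) (h : S.Recursive r) :
    P.map (fun ω i => x i ω) = ((P.map fun ω v => ε v ω).map
      (solve (fullRank M r) S.mechanism)).map fun z i => z (Sum.inl i) := by
  have h1 := measurable_solve (r := fullRank M r) h.measurable_mechanism
  rw [Measure.map_map h1 hS.measurable_noise_vector, Measure.map_map (by fun_prop)
    (h1.comp hS.measurable_noise_vector)]
  exact Measure.map_congr (hS.ae_observed_eq_solve h)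

/-- The residuals of variables without common latent parent are independent. -/
theorem indepFun_residual (hS : S.GeneratesData 𝓕 P x u ε) (h : S.Recursive r) {i j : Fin D}
    (hij : i ≠ j) (hd : Disjoint (S.paU (Sum.inl i)) (S.paU (Sum.inl j))) :
    IndepFun (fun ω => S.residual i fun l => x l ω) (fun ω => S.residual j fun l => x l ω) P := by
  classical
  -- The block of noises read by the residual of `x_l`: its own and those of its latent parents.
  let B : Fin D → Finset (Fin D ⊕ Fin M) := fun l => ({l} : Finset _).disjSum (S.paU (Sum.inl l))
  have hB : Disjoint (B i) (B j) := by
    rw [Finset.disjoint_left] at hd ⊢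
    rintro (a | a) ha hb
    · simp [B] at ha hb
      exact hij (ha.symm.trans hb)
    · exact hd (by simpa [B] using ha) (by simpa [B] using hb)
  let ψ : ∀ l, (B l → ℝ) → ℝ := fun l y => S.fU (Sum.inl l)
    (fun k => y ⟨Sum.inr k, by simp [B]⟩ + S.mechanism (Sum.inr k) 0) +
      y ⟨Sum.inl l, by simp [B]⟩
  have hψ : ∀ l, Measurable (ψ l) := fun l =>
    ((h.measurable_fU _).comp (by fun_prop)).add (by fun_prop)
  exact ((hS.indep.indepFun_finset (B i) (B j) hB hS.measurable_noise).comp (hψ i) (hψ j)).congr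
    (hS.residual_ae_eq h i).symm (hS.residual_ae_eq h j).symm

variable [IsProbabilityMeasure P]

theorem noise_law (hS : S.GeneratesData 𝓕 P x u ε) :
    P.map (fun ω v => ε v ω) = Measure.pi fun v => P.map (ε v) :=
  (iIndepFun_iff_map_fun_eq_pi_map fun v => (hS.measurable_noise v).aemeasurable).1 hS.indep

theorem volume_ac_noise (hS : S.GeneratesData 𝓕 P x u ε) :
    volume ≪ P.map fun ω v => ε v ω := by
  have := fun v => Measure.isProbabilityMeasure_map (μ := P) (hS.measurable_noise v).aemeasurable
  rw [hS.noise_law]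
  exact absolutelyContinuous_pi hS.noise_positive

theorem noise_ac_volume (hS : S.GeneratesData 𝓕 P x u ε) :
    P.map (fun ω v => ε v ω) ≪ volume := by
  have := fun v => Measure.isProbabilityMeasure_map (μ := P) (hS.measurable_noise v).aemeasurable
  rw [hS.noise_law]
  exact absolutelyContinuous_pi hS.noise_density

/-- This turns Lebesgue-a.e. identities between functions of `x` into almost sure ones. -/
theorem observed_ac_volume (hS : S.GeneratesData 𝓕 P x u ε) (h : S.Recursive r) :
    P.map (fun ω i => x i ω) ≪ volume := by
  rw [hS.observed_law h]
  have h1 := measurePreserving_solve h.measurable_mechanism h.dependsOn_mechanism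
  have h2 := quasiMeasurePreserving_comp_injective (Sum.inl_injective (α := Fin D) (β := Fin M))
  refine ((hS.noise_ac_volume.map h1.measurable).map h2.measurable).trans ?_
  rw [h1.map_eq]
  exact h2.absolutelyContinuous

/-- A function of observed variables of rank at most that of `x_w` which does not involve the noise
of `x_w` is almost everywhere constant in `x_w`. -/
theorem isAEConstantIn_of_not_involves (hS : S.GeneratesData 𝓕 P x u ε) (h : S.Recursive r)
    {F : (Fin D → ℝ) → ℝ} (hF : Measurable F) {w : Fin D}
    (hd : DependsOn F {m | r m ≤ r w})
    (hw : ¬ Involves P ε (fun ω => F fun i => x i ω) (Sum.inl w)) : IsAEConstantIn F w := by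
  set X := solve (fullRank M r) S.mechanism with hX
  have hXm : Measurable X := measurable_solve h.measurable_mechanism
  have h1 : IsAEConstantIn (fun e => F fun i => X e (Sum.inl i)) (Sum.inl w) := by
    refine _root_.isAEConstantIn_of_not_involves hS.measurable_noise hS.volume_ac_noise
      (hF.comp (measurable_pi_lambda _ fun i => hXm.eval)) ?_ hw
    filter_upwards [hS.ae_observed_eq_solve h] with ω hω
    exact congrArg F hω
  have h2 : ∀ᵐ e, ∀ᵐ t : ℝ, F (Function.update (fun i => X e (Sum.inl i)) w t) =
      F fun i => X e (Sum.inl i) := by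
    filter_upwards [h1] with e he
    -- Among the arguments of `F` the noise of `x_w` moves only `x_w`, by a translation; almost
    -- every noise value thus gives almost every value of `x_w`.
    refine ae_of_ae_add_right (S.mechanism (Sum.inl w) (X e)) ?_
    filter_upwards [he] with t ht
    rw [← ht]
    refine hd fun m (hm : r m ≤ r w) => ?_
    by_cases hmw : m = w
    · subst hmw
      rw [Function.update_self, hX, solve_update_self h.dependsOn_mechanism]
    · rw [Function.update_of_ne hmw, hX, solve_update_of_le h.dependsOn_mechanism _ _ _ _ _ rfl
        (by simpa [fullRank] using hm) (by simpa using hmw)]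
  refine ae_of_ae_comp_injective (Sum.inl_injective (α := Fin D) (β := Fin M)) ?_
    (measurableSet_ae_update_eq hF w)
  -- Pulling back along the shear replaces solutions by arbitrary points `z`.
  have h3 := (measurePreserving_shear h.measurable_mechanism
    h.dependsOn_mechanism).quasiMeasurePreserving.ae h2
  filter_upwards [h3] with z hz
  rwa [hX, solve_shear h.dependsOn_mechanism] at hz

/-- The noise of `u_k` enters the residual only through the argument `u_k` of `fU`, on which `fU`
effectively depends. -/
theorem involves_residual_latent (hS : S.GeneratesData 𝓕 P x u ε) (h : S.Recursive r) {i : Fin D}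
    {k : Fin M} (hk : k ∈ S.paU (Sum.inl i)) :
    Involves P ε (fun ω => S.residual i fun l => x l ω) (Sum.inr k) := by
  intro hn
  have hfU := h.measurable_fU (Sum.inl i)
  let c : Fin D ⊕ Fin M → ℝ := fun v => S.mechanism v 0
  have h1 := _root_.isAEConstantIn_of_not_involves hS.measurable_noise hS.volume_ac_noise
    (F := fun e : Fin D ⊕ Fin M → ℝ => S.fU (Sum.inl i) (fun k => e (Sum.inr ↑k) + c (Sum.inr ↑k)) + e (Sum.inl i))
    ((hfU.comp (by fun_prop)).add (by fun_prop)) (hS.residual_ae_eq h i) (not_not.2 hn)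
  have h2 : IsAEConstantIn (fun e : Fin D ⊕ Fin M → ℝ =>
      S.fU (Sum.inl i) fun k => e (Sum.inr ↑k)) (Sum.inr k) := by
    have h3 := (measurePreserving_sub_right volume c).quasiMeasurePreserving.ae h1
    filter_upwards [h3] with e he
    refine ae_of_ae_add_right (c (Sum.inr k)) ?_
    filter_upwards [he] with t ht
    simp only [Pi.sub_apply, sub_add_cancel, ne_eq, reduceCtorEq, not_false_eq_true,
      Function.update_of_ne, add_left_inj] at ht
    rw [← ht]
    congr 1
    funext m
    by_cases hm : (m : Fin M) = k
    · simp [hm]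
    · have : (Sum.inr (m : Fin M) : Fin D ⊕ Fin M) ≠ Sum.inr k := by simpa using hm
      simp [Function.update_of_ne this]
  exact (IsAEConstantIn.of_comp_injective
    (j := fun m : S.paU (Sum.inl i) => (Sum.inr (m : Fin M) : Fin D ⊕ Fin M))
    (Sum.inr_injective.comp Subtype.val_injective) hfU (l := ⟨k, hk⟩)
    h2).not_effectivelyDependsOn hfU ((hS.fU_nonlinear _).depends _)

end GeneratesData

end MagnifiedSCM

/-! ### Transfer between models and auxiliary facts -/

theorem indepFun_comp_iff_map {Ω α : Type*} [MeasurableSpace Ω] [MeasurableSpace α]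
    {P : Measure Ω} {X : Ω → α} (hX : Measurable X) {F F' : α → ℝ} (hF : Measurable F)
    (hF' : Measurable F') :
    IndepFun (fun ω => F (X ω)) (fun ω => F' (X ω)) P ↔ IndepFun F F' (P.map X) := by
  rw [indepFun_iff_measure_inter_preimage_eq_mul, indepFun_iff_measure_inter_preimage_eq_mul]
  refine forall₄_congr fun s t hs ht => ?_
  rw [Measure.map_apply hX ((hF hs).inter (hF' ht)), Measure.map_apply hX (hF hs),
    Measure.map_apply hX (hF' ht)]
  rfl

theorem indepFun_comp_iff_of_map_eq {Ω Ω' α : Type*} [MeasurableSpace Ω] [MeasurableSpace Ω']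
    [MeasurableSpace α] {P : Measure Ω} {P' : Measure Ω'} {X : Ω → α} {X' : Ω' → α}
    (hX : Measurable X) (hX' : Measurable X') (hlaw : P.map X = P'.map X') {F F' : α → ℝ}
    (hF : Measurable F) (hF' : Measurable F') :
    IndepFun (fun ω => F (X ω)) (fun ω => F' (X ω)) P ↔
      IndepFun (fun ω => F (X' ω)) (fun ω => F' (X' ω)) P' := by
  rw [indepFun_comp_iff_map hX hF hF', indepFun_comp_iff_map hX' hF hF', hlaw]

theorem IsAEConstantIn.neg_iff {ι : Type*} [Fintype ι] [DecidableEq ι] {F : (ι → ℝ) → ℝ} {w : ι} :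
    IsAEConstantIn (fun z => -F z) w ↔ IsAEConstantIn F w := by
  simp only [IsAEConstantIn, neg_inj]

theorem Involves.sub_of_eq_comp {Ω ι : Type*} [MeasurableSpace Ω] {P : Measure Ω}
    {ε : ι → Ω → ℝ} {l : ι} {R R' : Ω → ℝ} (hR : Involves P ε (fun ω => R ω - R' ω) l)
    (hR' : ∃ h : ({m : ι // m ≠ l} → ℝ) → ℝ, Measurable h ∧
      R' =ᵐ[P] fun ω => h fun m => ε m ω) : Involves P ε R l := by
  rintro ⟨h, hm, he⟩
  obtain ⟨h', hm', he'⟩ := hR'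
  refine hR ⟨fun y => h y - h' y, hm.sub hm', ?_⟩
  filter_upwards [he, he'] with ω h1 h2
  rw [h1, h2]

/-- A function that effectively depends on `x_w` cannot be compensated by a function without
`x_w`. -/
theorem not_isAEConstantIn_sub {D : ℕ} {s : Finset (Fin D)} {g : (s → ℝ) → ℝ} (hg : IsNonlinear g)
    {a : (Fin D → ℝ) → ℝ} {w : Fin D} (hw : w ∈ s)
    (ha : ∀ z t, a (Function.update z w t) = a z) :
    ¬ IsAEConstantIn (fun z : Fin D → ℝ => a z - g fun m => z m) w := by
  intro h
  have h1 : IsAEConstantIn (fun z : Fin D → ℝ => g fun m => z m) w := by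
    filter_upwards [h] with z hz
    filter_upwards [hz] with t ht
    rw [ha] at ht
    linarith
  exact (IsAEConstantIn.of_comp_injective (j := fun m : s => (m : Fin D))
    Subtype.val_injective hg.measurable (l := ⟨w, hw⟩) h1).not_effectivelyDependsOn
    hg.measurable (hg.depends _)

theorem comp_update_of_notMem {D : ℕ} {s : Finset (Fin D)} {w : Fin D} (hw : w ∉ s)
    (z : Fin D → ℝ) (t : ℝ) :
    (fun m : s => Function.update z w t m) = fun m : s => z m :=
  funext fun m => Function.update_of_ne (fun h : (m : Fin D) = w => hw (by rw [← h]; exact m.2)) _ _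

/-- The number of ancestors of a vertex. -/
noncomputable def ADMG.rank {D : ℕ} (G : ADMG D) (i : Fin D) : ℕ :=
  {j | Relation.TransGen (fun a b => G.GD a b = true) j i}.ncard

/-- Ancestors of `i` are ancestors of `j`; acyclicity makes the inclusion strict, as `i` is an
ancestor of `j` but not of itself. -/
theorem ADMG.rank_lt {D : ℕ} (G : ADMG D) {i j : Fin D} (h : G.GD i j = true) :
    G.rank i < G.rank j := by
  refine Set.ncard_lt_ncard ⟨fun k hk => Relation.TransGen.tail hk h, fun hs => ?_⟩
    (Set.toFinite _)
  exact G.acyclic i (hs (Relation.TransGen.single h))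

/-! ### Comparison of two models -/

namespace MagnifiedSCM

variable {D M : ℕ} {𝓕 : FunctionClass D} {S : MagnifiedSCM D M} {r : Fin D → ℕ}
  {Ω : Type*} [MeasurableSpace Ω] {P : Measure Ω}
  {x : Fin D → Ω → ℝ} {u : Fin M → Ω → ℝ} {ε : Fin D ⊕ Fin M → Ω → ℝ}

theorem GeneratesData.recursive (hS : S.GeneratesData 𝓕 P x u ε)
    (h𝓕 : ∀ s, ∀ g ∈ 𝓕 s, IsNonlinear g) {G : ADMG D} (hG : S.IsMagnificationOf G)
    (hlatent : S.LatentsConfoundUniquePairs) : S.Recursive G.rank where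
  paX_latent k := (hlatent.parentless k).1
  paU_latent k := (hlatent.parentless k).2
  rank_lt i m hm := G.rank_lt ((hG.directed m i).2 hm)
  measurable_fX v := (h𝓕 _ _ (hS.fX_mem v)).measurable
  measurable_fU v := (hS.fU_nonlinear v).measurable

/-- Variables joined by a directed edge have no common latent parent. -/
theorem LatentsConfoundUniquePairs.disjoint_paU (hlatent : S.LatentsConfoundUniquePairs)
    {v w : Fin D} (hvw : v ≠ w) (hw : w ∈ S.paX (Sum.inl v)) :
    Disjoint (S.paU (Sum.inl v)) (S.paU (Sum.inl w)) := by
  rw [Finset.disjoint_left]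
  intro k hkv hkw
  obtain ⟨i, j, _, hi, hj, hk⟩ := hlatent.pair k
  rcases (hk v).1 hkv with rfl | rfl <;> rcases (hk w).1 hkw with rfl | rfl
  exacts [hvw rfl, hj hw, hi hw, hvw rfl]

theorem Recursive.ne_of_mem (h : S.Recursive r) {v w : Fin D} (hw : w ∈ S.paX (Sum.inl v)) :
    v ≠ w := by
  rintro rfl
  exact lt_irrefl _ (h.rank_lt _ _ hw)

variable [IsProbabilityMeasure P]

/-- Residual dependence is the same as having a common latent parent. -/
theorem GeneratesData.indepFun_residual_iff (hS : S.GeneratesData 𝓕 P x u ε) (h : S.Recursive r)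
    (hRF : ResidualFaithful 𝓕 P x ε) {i j : Fin D} (hij : i ≠ j) :
    IndepFun (fun ω => S.residual i fun l => x l ω) (fun ω => S.residual j fun l => x l ω) P ↔
      Disjoint (S.paU (Sum.inl i)) (S.paU (Sum.inl j)) := by
  refine ⟨fun hind => ?_, hS.indepFun_residual h hij⟩
  rw [Finset.disjoint_left]
  intro k hi hj
  exact hRF i j hij _ _ (fun hn => h.ne_of_mem hn rfl) (fun hn => h.ne_of_mem hn rfl) _
    (hS.fX_mem _) _ (hS.fX_mem _) ⟨Sum.inr k, hS.involves_residual_latent h hi,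
      hS.involves_residual_latent h hj⟩ hind

/-- A residual involves the noise of the variables of largest rank that it is formed with. -/
theorem GeneratesData.involves_regResidual (hS : S.GeneratesData 𝓕 P x u ε) (h : S.Recursive r)
    {i w : Fin D} {s : Finset (Fin D)} {g : (s → ℝ) → ℝ} (hg : IsNonlinear g) (hi : i ∉ s)
    (hw : w = i ∨ w ∈ s) (hri : r i ≤ r w) (hrs : ∀ m ∈ s, r m ≤ r w) :
    Involves P ε (regResidual x i s g) (Sum.inl w) := by
  by_contra hn
  have hc : IsAEConstantIn (fun z : Fin D → ℝ => z i - g fun m => z m) w := by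
    refine hS.isAEConstantIn_of_not_involves h
      ((measurable_pi_apply i).sub (hg.measurable.comp (by fun_prop))) (fun a b hab => ?_) hn
    have h1 : (fun m : s => a m) = fun m : s => b m := funext fun m => hab m (hrs m m.2)
    have h2 : a i = b i := hab i hri
    exact congrArg₂ (· - ·) h2 (congrArg g h1)
  -- If `w = i`, the residual has slope one in `x_i`, which `g` does not read; otherwise `g`
  -- effectively depends on `x_w` and `x_i` cannot compensate.
  by_cases hwi : w = i
  · subst hwi
    obtain ⟨z, hz⟩ := hc.exists
    have h1 : ∀ᵐ t : ℝ, t = z w := by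
      filter_upwards [hz] with t ht
      rw [comp_update_of_notMem hi, Function.update_self] at ht
      linarith
    obtain ⟨t, ht, ht'⟩ := (h1.and (Measure.ae_ne volume (z w))).exists
    exact ht' ht
  · exact not_isAEConstantIn_sub hg (a := fun z => z i) (hw.resolve_left hwi)
      (fun z t => Function.update_of_ne (Ne.symm hwi) _ _) hc

/-- A function of the observed variables whose relevant arguments have rank at most that of `x_w`
and which does not involve the noise of `x_w` is almost everywhere constant in `x_w`. -/
theorem GeneratesData.isAEConstantIn_of_forall (hS : S.GeneratesData 𝓕 P x u ε)
    (h : S.Recursive r) {F : (Fin D → ℝ) → ℝ} (hF : Measurable F) {w : Fin D}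
    (hmax : ∀ m, ¬ IsAEConstantIn F m → r m ≤ r w)
    (hw : ¬ Involves P ε (fun ω => F fun i => x i ω) (Sum.inl w)) : IsAEConstantIn F w := by
  classical
  -- Irrelevant arguments may have large rank, so `F` is first replaced by a version that does not
  -- read them.
  obtain ⟨F', hm, he, hd⟩ := exists_dependsOn_of_isAEConstantIn hF
    (Finset.univ.filter fun m => IsAEConstantIn F m) (by simp)
  refine (hS.isAEConstantIn_of_not_involves h hm
    (hd.mono fun m hmem => hmax m (by simpa using hmem)) fun hinv => hinv ?_).congr he.symm
  obtain ⟨h', hm', he'⟩ := not_not.1 hw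
  refine ⟨h', hm', ?_⟩
  have h1 : ∀ᵐ z ∂P.map (fun ω i => x i ω), F z = F' z := (hS.observed_ac_volume h).ae_le he
  filter_upwards [ae_of_ae_map hS.measurable_observed.aemeasurable h1, he'] with ω h2 h3
  rw [← h2, h3]

variable {M' : ℕ} {S' : MagnifiedSCM D M'}

/-- In a second model of the same data, the parents have smaller rank with respect to the
first one. -/
theorem GeneratesData.rank_lt_of_indepFun (hS : S.GeneratesData 𝓕 P x u ε) (h : S.Recursive r)
    (hRF : ResidualFaithful 𝓕 P x ε) (h𝓕 : ∀ s, ∀ g ∈ 𝓕 s, IsNonlinear g) {r' : Fin D → ℕ}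
    (h' : S'.Recursive r') (hfX : ∀ v, S'.fX v ∈ 𝓕 (S'.paX v))
    (hind : ∀ v, ∀ w ∈ S'.paX (Sum.inl v), IndepFun (fun ω => S'.residual v fun l => x l ω)
      (fun ω => S'.residual w fun l => x l ω) P) :
    ∀ n v, r' v = n → ∀ w ∈ S'.paX (Sum.inl v), r w < r v := by
  intro n
  induction n using Nat.strong_induction_on with
  | _ n ih =>
    intro v hv w₀ hw₀
    by_contra hlt
    obtain ⟨w, hw, hmax⟩ := Finset.exists_max_image (S'.paX (Sum.inl v)) r ⟨w₀, hw₀⟩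
    have hvw : r v ≤ r w := (not_lt.1 hlt).trans (hmax w₀ hw₀)
    have hself : ∀ v, v ∉ S'.paX (Sum.inl v) := fun v hn => h'.ne_of_mem hn rfl
    refine hRF v w (h'.ne_of_mem hw) _ _ (hself v) (hself w) _ (hfX _) _ (hfX _)
      ⟨Sum.inl w, ?_, ?_⟩ (hind v w hw)
    · exact hS.involves_regResidual h (h𝓕 _ _ (hfX _)) (hself v) (Or.inr hw) hvw hmax
    · exact hS.involves_regResidual h (h𝓕 _ _ (hfX _)) (hself w) (Or.inl rfl) le_rfl
        fun m hm => (ih (r' w) (hv ▸ h'.rank_lt v w hw) w rfl m hm).le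

/-- The difference of the residuals of `x_v` in two models of the same data does not involve the
noise of the parents of `x_v` in the other model. -/
theorem GeneratesData.not_involves_residual_sub (hS : S.GeneratesData 𝓕 P x u ε)
    (h : S.Recursive r) (hRF : ResidualFaithful 𝓕 P x ε)
    (h𝓕 : ∀ s, ∀ g ∈ 𝓕 s, IsNonlinear g) (h' : S'.Recursive r)
    (hfX : ∀ v, S'.fX v ∈ 𝓕 (S'.paX v)) {v w : Fin D} (hw : w ∈ S'.paX (Sum.inl v))
    (hind : IndepFun (fun ω => S'.residual v fun l => x l ω)
      (fun ω => S'.residual w fun l => x l ω) P) :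
    ¬ Involves P ε (fun ω => S'.residual v (fun l => x l ω) - S.residual v fun l => x l ω)
      (Sum.inl w) := by
  have hne := h'.ne_of_mem hw
  intro hinv
  refine hRF v w hne _ _ (fun hn => h'.ne_of_mem hn rfl) (fun hn => h'.ne_of_mem hn rfl) _
    (hfX _) _ (hfX _) ⟨Sum.inl w, ?_, ?_⟩ hind
  · refine Involves.sub_of_eq_comp hinv ⟨fun y => S.fU (Sum.inl v)
      (fun k => y ⟨Sum.inr k, by simp⟩ + S.mechanism (Sum.inr k) 0) +
        y ⟨Sum.inl v, by simpa using hne⟩, ?_, hS.residual_ae_eq h v⟩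
    exact ((h.measurable_fU _).comp (by fun_prop)).add (by fun_prop)
  · exact hS.involves_regResidual h (h𝓕 _ _ (hfX _)) (fun hn => h'.ne_of_mem hn rfl) (Or.inl rfl)
      le_rfl fun m hm => (h'.rank_lt w m hm).le

variable {Ω' : Type*} [MeasurableSpace Ω'] {P' : Measure Ω'} [IsProbabilityMeasure P']
  {x' : Fin D → Ω' → ℝ} {u' : Fin M' → Ω' → ℝ} {ε' : Fin D ⊕ Fin M' → Ω' → ℝ}

/-- The residuals in two models of the same data differ by constants. -/
theorem GeneratesData.isAEConstantIn_residual_sub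
    (h𝓕 : ∀ s, ∀ g ∈ 𝓕 s, IsNonlinear g)
    (hS : S.GeneratesData 𝓕 P x u ε) (h : S.Recursive r) (hRF : ResidualFaithful 𝓕 P x ε)
    (hlatent : S.LatentsConfoundUniquePairs)
    (hS' : S'.GeneratesData 𝓕 P' x' u' ε') (h' : S'.Recursive r)
    (hRF' : ResidualFaithful 𝓕 P' x' ε') (hlatent' : S'.LatentsConfoundUniquePairs)
    (hlaw : P'.map (fun ω i => x' i ω) = P.map fun ω i => x i ω) (v w : Fin D) :
    IsAEConstantIn (fun z => S'.residual v z - S.residual v z) w := by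
  classical
  set F : (Fin D → ℝ) → ℝ := fun z => S'.residual v z - S.residual v z with hFdef
  have hF : Measurable F := (h'.measurable_residual v).sub (h.measurable_residual v)
  by_contra hbad
  obtain ⟨w, hw, hmax⟩ := Finset.exists_max_image
    (Finset.univ.filter fun m => ¬ IsAEConstantIn F m) r ⟨w, by simpa using hbad⟩
  replace hw : ¬ IsAEConstantIn F w := by simpa using hw
  replace hmax : ∀ m, ¬ IsAEConstantIn F m → r m ≤ r w := fun m hm => hmax m (by simpa using hm)
  by_cases h1 : w ∈ S'.paX (Sum.inl v)
  · refine hw (hS.isAEConstantIn_of_forall h hF hmax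
      (hS.not_involves_residual_sub h hRF h𝓕 h' hS'.fX_mem h1
      ((indepFun_comp_iff_of_map_eq hS.measurable_observed hS'.measurable_observed hlaw.symm
        (h'.measurable_residual v) (h'.measurable_residual w)).2 ?_)))
    exact hS'.indepFun_residual h' (h'.ne_of_mem h1)
      (hlatent'.disjoint_paU (h'.ne_of_mem h1) h1)
  · by_cases h2 : w ∈ S.paX (Sum.inl v)
    · have hneg : (fun z => S.residual v z - S'.residual v z) = fun z => -F z :=
        funext fun z => (neg_sub _ _).symm
      have hneg' : ∀ m, IsAEConstantIn (fun z => -F z) m =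
          IsAEConstantIn (S.residual v - S'.residual v) m := fun m => by rw [← hneg]; rfl
      refine hw (IsAEConstantIn.neg_iff.1 (hneg ▸ hS'.isAEConstantIn_of_forall h'
        ((h.measurable_residual v).sub (h'.measurable_residual v))
        (fun m hm => hmax m fun hn => hm (hneg' m ▸ IsAEConstantIn.neg_iff.2 hn))
        (hS'.not_involves_residual_sub h' hRF' h𝓕 h hS.fX_mem h2
          ((indepFun_comp_iff_of_map_eq hS.measurable_observed hS'.measurable_observed hlaw.symm
            (h.measurable_residual v) (h.measurable_residual w)).1 ?_))))
      exact hS.indepFun_residual h (h.ne_of_mem h2)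
        (hlatent.disjoint_paU (h.ne_of_mem h2) h2)
    · refine hw (ae_of_all _ fun z => ae_of_all _ fun t => ?_)
      simp only [hFdef, residual, comp_update_of_notMem h1, comp_update_of_notMem h2]
      ring

/-- Two models of the same data have the same directed edges. -/
theorem GeneratesData.paX_subset
    (h𝓕 : ∀ s, ∀ g ∈ 𝓕 s, IsNonlinear g)
    (hfX : ∀ v, S.fX v ∈ 𝓕 (S.paX v)) {v : Fin D} (hself : v ∉ S.paX (Sum.inl v))
    (hc : ∀ w, IsAEConstantIn (fun z => S.residual v z - S'.residual v z) w) :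
    S.paX (Sum.inl v) ⊆ S'.paX (Sum.inl v) := by
  intro w hw
  by_contra hw'
  have hvw : v ≠ w := fun hvw => hself (hvw ▸ hw)
  -- Here `a` is the function of `x_v` in `S'`, free of `x_w`, and the difference of residuals is
  -- `a` minus the function in `S`.
  refine not_isAEConstantIn_sub (h𝓕 _ _ (hfX _)) (a := fun z => z v - S'.residual v z) hw
    (fun z t => ?_) (?_ : IsAEConstantIn _ w)
  · simp only [residual, comp_update_of_notMem hw']
    ring
  · convert hc w using 2 with z
    simp only [residual]
    ring

/-- A function which is almost everywhere constant in all the coordinates is almost everywhere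
constant. -/
theorem exists_ae_eq_const {F : (Fin D → ℝ) → ℝ} (hF : Measurable F)
    (h : ∀ w, IsAEConstantIn F w) : ∃ c, ∀ᵐ z, F z = c := by
  obtain ⟨F', -, he, hd⟩ := exists_dependsOn_of_isAEConstantIn hF Finset.univ fun w _ => h w
  refine ⟨F' 0, ?_⟩
  filter_upwards [he] with z hz
  rw [hz]
  exact hd fun i hi => absurd hi (by simp)

/-- Two models of the same data have the same graphs. -/
theorem GeneratesData.paX_eq_and_disjoint_iff
    (h𝓕 : ∀ s, ∀ g ∈ 𝓕 s, IsNonlinear g)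
    (hS : S.GeneratesData 𝓕 P x u ε) (h : S.Recursive r) (hRF : ResidualFaithful 𝓕 P x ε)
    (hlatent : S.LatentsConfoundUniquePairs)
    (hS' : S'.GeneratesData 𝓕 P' x' u' ε') {r' : Fin D → ℕ} (hr' : S'.Recursive r')
    (hRF' : ResidualFaithful 𝓕 P' x' ε') (hlatent' : S'.LatentsConfoundUniquePairs)
    (hlaw : P'.map (fun ω i => x' i ω) = P.map fun ω i => x i ω) :
    (∀ v, S.paX (Sum.inl v) = S'.paX (Sum.inl v)) ∧
      ∀ i j, i ≠ j → (Disjoint (S.paU (Sum.inl i)) (S.paU (Sum.inl j)) ↔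
        Disjoint (S'.paU (Sum.inl i)) (S'.paU (Sum.inl j))) := by
  -- The second model is recursive for the rank of the first, so maximal-rank arguments apply to
  -- both with the same order.
  have h' : S'.Recursive r := { hr' with
    rank_lt := fun v => hS.rank_lt_of_indepFun h hRF h𝓕 hr' hS'.fX_mem (fun v w hw =>
      (indepFun_comp_iff_of_map_eq hS.measurable_observed hS'.measurable_observed hlaw.symm
        (hr'.measurable_residual v) (hr'.measurable_residual w)).2
        (hS'.indepFun_residual hr' (hr'.ne_of_mem hw)
          (hlatent'.disjoint_paU (hr'.ne_of_mem hw) hw))) _ v rfl }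
  have hc := hS.isAEConstantIn_residual_sub h𝓕 h hRF hlatent hS' h' hRF' hlatent' hlaw
  have hc' := hS'.isAEConstantIn_residual_sub h𝓕 h' hRF' hlatent' hS h hRF hlatent hlaw.symm
  refine ⟨fun v => Finset.Subset.antisymm
    (paX_subset h𝓕 hS.fX_mem (fun hn => h.ne_of_mem hn rfl) (hc' v))
    (paX_subset h𝓕 hS'.fX_mem (fun hn => h'.ne_of_mem hn rfl) (hc v)), fun i j hij => ?_⟩
  have hshift : ∀ v, ∃ c, (fun ω => S'.residual v fun l => x l ω) =ᵐ[P]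
      fun ω => (S.residual v fun l => x l ω) + c := fun v => by
    obtain ⟨c, hcv⟩ := exists_ae_eq_const
      ((h'.measurable_residual v).sub (h.measurable_residual v)) (hc v)
    refine ⟨c, ?_⟩
    filter_upwards [ae_of_ae_map hS.measurable_observed.aemeasurable
      ((hS.observed_ac_volume h).ae_le hcv)] with ω hω
    simp only [Pi.sub_apply] at hω
    linarith
  obtain ⟨a, ha⟩ := hshift i
  obtain ⟨b, hb⟩ := hshift j
  have hadd : ∀ c : ℝ, Measurable fun t : ℝ => t + c := fun c => measurable_id.add_const c
  rw [← hS.indepFun_residual_iff h hRF hij, ← hS'.indepFun_residual_iff h' hRF' hij,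
    ← indepFun_comp_iff_of_map_eq hS.measurable_observed hS'.measurable_observed hlaw.symm
      (h'.measurable_residual i) (h'.measurable_residual j)]
  refine ⟨fun hI => (hI.comp (hadd a) (hadd b)).congr ha.symm hb.symm, fun hI => ?_⟩
  refine (hI.comp (hadd (-a)) (hadd (-b))).congr ?_ ?_
  · filter_upwards [ha] with ω hω
    simp [hω]
  · filter_upwards [hb] with ω hω
    simp [hω]

end MagnifiedSCM

theorem mainTheorem1 {D M : ℕ} {Ω : Type*} [MeasurableSpace Ω]
    (𝓕 : FunctionClass D) (h𝓕 : ∀ s, ∀ g ∈ 𝓕 s, IsNonlinear g)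
    (G : ADMG D) (S : MagnifiedSCM D M) (hG : S.IsMagnificationOf G)
    (P : Measure Ω) [IsProbabilityMeasure P]
    (x : Fin D → Ω → ℝ) (u : Fin M → Ω → ℝ) (ε : Fin D ⊕ Fin M → Ω → ℝ)
    (hS : S.GeneratesData 𝓕 P x u ε)
    (hlatent : S.LatentsConfoundUniquePairs)
    (hRF : ResidualFaithful 𝓕 P x ε) :
    StructurallyIdentifiable 𝓕 G (P.map (fun ω i => x i ω)) := by
  rintro ⟨G', hne, M', S', Ω', _, P', x', u', ε', _, hG', hS', hlatent', hRF', hlaw⟩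
  obtain ⟨hX, hU⟩ := hS.paX_eq_and_disjoint_iff h𝓕 (hS.recursive h𝓕 hG hlatent) hRF hlatent hS'
    (hS'.recursive h𝓕 hG' hlatent') hRF' hlatent' hlaw
  refine hne (Prod.ext (funext₂ fun i j => Bool.eq_iff_iff.2 ?_)
    (funext₂ fun i j => Bool.eq_iff_iff.2 ?_))
  · exact (hG'.directed i j).trans (hX j ▸ (hG.directed i j).symm)
  · refine (hG'.bidirected i j).trans (Iff.trans ?_ (hG.bidirected i j).symm)
    refine and_congr_right fun hij => ?_
    -- For distinct vertices a bidirected edge means that the sets of latent parents meet.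
    have := not_congr (hU i j hij)
    rw [Finset.not_disjoint_iff, Finset.not_disjoint_iff] at this
    exact this.symm
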